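/- All graphs are finite and simple. A graph is a \emph{cograph} if it has no induced path on four vertices. A graph $G$ is \emph{$k$-polar} if $V(G)$ can be partitioned into (possibly empty) sets $A$ and $B$ such that $G[A]$ is a complete multipartite graph with at most $k$ parts and $G[B]$ is a disjoint union of at most $k$ cliques with no other edges. A \emph{cograph minimal $k$-polar obstruction} is a cograph that is not $k$-polar, but all of whose proper induced subgraphs are $k$-polar. Write $G+H$ for the disjoint union, $G\oplus H$ for the join, $nG$ for the disjoint union of $n$ copies of $G$ (the empty graph if $n=0$), and $\overline{G}$ for the complement; $K_n$, $P_n$, $C_n$ denote the complete graph, path and cycle on $n$ vertices, and $K_{m,n}$ the complete bipartite graph. \textbf{Lemma.} For every integer $k\ge 2$, each of the following 24 graphs is a cograph minimal $k$-polar obstruction: \begin{enumerate} \item $K_1+(k+1)K_2$ \item $C_4+P_3+(k-2)K_2$ \item $\bigl((K_1+2K_2)\oplus K_1\bigr)+K_1+(k-2)K_2$ \item $\overline{2K_2+(k-1)K_1}+kK_1$ \item $\overline{(k+1)K_2}+(k-1)K_1$ \item $2P_3+(k-1)K_2$ \item $\overline{P_3+K_2}+(k-1)K_2+K_1$ \item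 $\overline{2P_3}+kK_1$ \item $((P_3+K_2)\oplus K_1)+kK_1$ \item $\bigl((\overline{K_2+(k-1)K_1}+K_2)\oplus\overline{K_2}\bigr)+(k-1)K_1$ \item $(2P_3\oplus K_1)+(k-1)K_1$ \item $\bigl(K_1\oplus(K_1+(2K_1\oplus(K_2+K_1)))\bigr)+(k-1)K_1$ \item $C_4+(k-1)K_2+2K_1$ \item $\overline{K_2+kK_1}+kK_2$ \item $(2K_k\oplus\overline{K_2})+(k-1)K_2$ \item $(2K_2\oplus K_1)+P_3+(k-2)K_2$ \item $(2K_2\oplus K_2)+kK_1$ \item $(2K_k\oplus P_3)+(k-1)K_1$ \item $((K_2+\overline{K_2})\oplus\overline{K_2})+\overline{K_2}+(k-2)K_2$ \item $\bigl((C_4+2K_1)\oplus K_1\bigr)+K_1+(k-2)K_1$ \item $K_{k+1,k+1}+(k+1)K_1$ \item $(k+1)K_{k+1}$ \item $(2K_{k+1}\oplus K_1)+(k-1)K_2$ \item $(2K_{k+1}\oplus K_2)+(k-1)K_1$ \end{enumerate} -/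

import Mathlib

namespace PolarObstruction

/-- `G` is a complete multipartite graph with at most `n` parts: its vertices can be distributed
over `n` (possibly empty) parts so that two vertices are adjacent exactly when they lie in
different parts. -/
def IsCompleteMultipartiteLE {V : Type*} (n : ℕ) (G : SimpleGraph V) : Prop :=
  ∃ part : V → Fin n, ∀ u v : V, G.Adj u v ↔ part u ≠ part v

/-- `G` is a disjoint union of at most `n` cliques, with no other edges: its vertices can be
distributed over `n` (possibly empty) parts so that two distinct vertices are adjacent exactly
when they lie in the same part. -/
def IsClusterLE {V : Type*} (n : ℕ) (G : SimpleGraph V) : Prop :=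
  ∃ part : V → Fin n, ∀ u v : V, G.Adj u v ↔ u ≠ v ∧ part u = part v

/-- `G` is `(s, k)`-polar: the vertex set splits into `A` and its complement `B` so that `G[A]` is
complete multipartite with at most `s` parts and `G[B]` is a disjoint union of at most `k`
cliques. -/
def IsPolar {V : Type*} (s k : ℕ) (G : SimpleGraph V) : Prop :=
  ∃ A : Set V, IsCompleteMultipartiteLE s (G.induce A) ∧ IsClusterLE k (G.induce Aᶜ)

/-- `G` is `k`-polar: it is `(k, k)`-polar. -/
def IsKPolar {V : Type*} (k : ℕ) (G : SimpleGraph V) : Prop :=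
  IsPolar k k G

/-- `G` is a minimal `k`-polar obstruction: it is not `k`-polar, but every proper induced subgraph
of it is. -/
def IsMinimalKPolarObstruction {V : Type*} (k : ℕ) (G : SimpleGraph V) : Prop :=
  ¬ IsKPolar k G ∧ ∀ S : Set V, S ≠ Set.univ → IsKPolar k (G.induce S)

/-- `G` is a cograph: it has no induced path on four vertices. -/
def IsCograph {V : Type*} (G : SimpleGraph V) : Prop :=
  ¬ (SimpleGraph.pathGraph 4).IsIndContained G

/-- `G` is a cograph minimal `k`-polar obstruction. -/
def IsCographMinimalKPolarObstruction {V : Type*} (k : ℕ) (G : SimpleGraph V) : Prop :=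
  IsCograph G ∧ IsMinimalKPolarObstruction k G

/-- The join of `G` and `H`: their disjoint union together with all edges between them. -/
def join {V W : Type*} (G : SimpleGraph V) (H : SimpleGraph W) : SimpleGraph (V ⊕ W) :=
  (G ⊕g H) ⊔ completeBipartiteGraph V W

infixl:65 " ⊕j " => join

/-- The graph `n G`: the disjoint union of `n` copies of `G`. -/
def copies {V : Type*} (n : ℕ) (G : SimpleGraph V) : SimpleGraph (Fin n × V) where
  Adj x y := x.1 = y.1 ∧ G.Adj x.2 y.2
  symm := ⟨fun _ _ h => ⟨h.1.symm, h.2.symm⟩⟩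
  loopless := ⟨fun _ h => G.loopless.irrefl _ h.2⟩

/-- The complete graph `K_n`. -/
abbrev K (n : ℕ) : SimpleGraph (Fin n) := SimpleGraph.completeGraph (Fin n)

/-- The path `P_n` on `n` vertices. -/
abbrev P (n : ℕ) : SimpleGraph (Fin n) := SimpleGraph.pathGraph n

/-- The cycle `C_n` on `n` vertices. -/
abbrev C (n : ℕ) : SimpleGraph (Fin n) := SimpleGraph.cycleGraph n

/-- The complete bipartite graph `K_{m,n}`. -/
abbrev KB (m n : ℕ) : SimpleGraph (Fin m ⊕ Fin n) := completeBipartiteGraph (Fin m) (Fin n)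

end PolarObstruction

open PolarObstruction

namespace PolarObstruction

/-! ### Polarity as a colouring problem -/

variable {V W : Type*}

/-! For a fixed graph, the pairs (s, t) for which it is (s, t)-polar form an up-set of ℕ², so a
finite list of generators, its "corners", records it completely. These lists can be computed along a
cograph construction.

Complementation exchanges complete multipartite graphs with clusters, hence swaps s and t. In a
disjoint union G + H the clusters of the two sides add up, while the multipartite part either lies
on one side or, meeting both sides with no edges across, is a single independent part
(`isPolar_sum_iff`). A join is the complement of a disjoint union of complements. The building
blocks K_n and nK_m are handled directly.

Polarity is hereditary, so minimality only concerns the one-vertex deletions, and deleting a vertex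
of G + H deletes it from one summand. A `Profile` therefore carries the corners of the graph and of
all its vertex-deleted subgraphs, together with the cograph property, and instance resolution
assembles it for each of the 24 graphs. What remains is arithmetic in k. -/

/-- A colouring by "part colours" `α` and "clique colours" `β` that witnesses polarity of `G`. -/
def IsPolarColoring {α β : Type*} (G : SimpleGraph V) (c : V → α ⊕ β) : Prop :=
  (∀ u v i j, c u = .inl i → c v = .inl j → (G.Adj u v ↔ i ≠ j)) ∧
    ∀ u v i j, c u = .inr i → c v = .inr j → (G.Adj u v ↔ u ≠ v ∧ i = j)

theorem IsPolarColoring.comp {α β : Type*} {G : SimpleGraph V} {H : SimpleGraph W}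
    {c : W → α ⊕ β} (h : IsPolarColoring H c) (f : G ↪g H) : IsPolarColoring G (c ∘ f) := by
  refine ⟨fun u v i j hu hv => ?_, fun u v i j hu hv => ?_⟩
  · rw [← f.map_adj_iff]; exact h.1 _ _ _ _ hu hv
  · rw [← f.map_adj_iff, h.2 _ _ _ _ hu hv, f.injective.ne_iff]

theorem IsPolarColoring.map {α β α' β' : Type*} {G : SimpleGraph V} {c : V → α ⊕ β}
    (h : IsPolarColoring G c) (f : α ↪ α') (g : β ↪ β') :
    IsPolarColoring G (Sum.map f g ∘ c) := by
  refine ⟨fun u v i j hu hv => ?_, fun u v i j hu hv => ?_⟩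
  · rcases hcu : c u with a | a <;> rcases hcv : c v with b | b <;> simp_all
    rw [h.1 u v a b hcu hcv, ← hu, ← hv, f.injective.eq_iff]
  · rcases hcu : c u with a | a <;> rcases hcv : c v with b | b <;> simp_all
    rw [h.2 u v a b hcu hcv, ← hu, ← hv, g.injective.eq_iff]

theorem IsPolarColoring.isPolar {s t : ℕ} {α β : Type*} [Fintype α] [Fintype β]
    {G : SimpleGraph V} {c : V → α ⊕ β} (h : IsPolarColoring G c)
    (hs : Fintype.card α ≤ s) (ht : Fintype.card β ≤ t) : IsPolar s t G := by
  obtain ⟨f⟩ : Nonempty (α ↪ Fin s) := Function.Embedding.nonempty_of_card_le (by simpa)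
  obtain ⟨g⟩ : Nonempty (β ↪ Fin t) := Function.Embedding.nonempty_of_card_le (by simpa)
  have hA (u : {u | (c u).isLeft}) : ∃ i, c u = .inl i := by
    rcases hu : c u with i | i
    · exact ⟨i, rfl⟩
    · exact absurd (show (c u).isLeft from u.2) (by rw [hu]; simp)
  have hB (u : ({u | (c u).isLeft}ᶜ : Set V)) : ∃ i, c u = .inr i := by
    rcases hu : c u with i | i
    · exact absurd (show (c u).isLeft by simp [hu]) u.2
    · exact ⟨i, rfl⟩
  choose p hp using hA
  choose q hq using hB
  refine ⟨{u | (c u).isLeft}, ⟨fun u => f (p u), fun u v => ?_⟩, ⟨fun u => g (q u), fun u v => ?_⟩⟩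
  · rw [f.injective.ne_iff]; exact h.1 _ _ _ _ (hp u) (hp v)
  · rw [g.injective.eq_iff, Ne, ← Subtype.coe_inj]; exact h.2 _ _ _ _ (hq u) (hq v)

theorem isPolar_iff {s t : ℕ} {G : SimpleGraph V} :
    IsPolar s t G ↔ ∃ c : V → Fin s ⊕ Fin t, IsPolarColoring G c := by
  classical
  refine ⟨?_, fun ⟨c, hc⟩ => hc.isPolar (by simp) (by simp)⟩
  rintro ⟨A, ⟨p, hp⟩, ⟨q, hq⟩⟩
  refine ⟨fun u => if h : u ∈ A then .inl (p ⟨u, h⟩) else .inr (q ⟨u, h⟩),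
    fun u v i j hu hv => ?_, fun u v i j hu hv => ?_⟩
  · by_cases hA : u ∈ A <;> by_cases hB : v ∈ A <;> simp_all
  · by_cases hA : u ∈ A <;> by_cases hB : v ∈ A <;> simp_all

theorem IsPolar.of_embedding {s t : ℕ} {G : SimpleGraph V} {H : SimpleGraph W} (f : G ↪g H)
    (h : IsPolar s t H) : IsPolar s t G := by
  obtain ⟨c, hc⟩ := isPolar_iff.1 h
  exact isPolar_iff.2 ⟨_, hc.comp f⟩

theorem isPolar_congr {s t : ℕ} {G : SimpleGraph V} {H : SimpleGraph W} (e : G ≃g H) :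
    IsPolar s t G ↔ IsPolar s t H :=
  ⟨.of_embedding e.symm.toEmbedding, .of_embedding e.toEmbedding⟩

theorem IsPolar.compl {s t : ℕ} {G : SimpleGraph V} (h : IsPolar s t G) : IsPolar t s Gᶜ := by
  obtain ⟨c, hc⟩ := isPolar_iff.1 h
  refine isPolar_iff.2 ⟨Sum.swap ∘ c, fun u v i j hu hv => ?_, fun u v i j hu hv => ?_⟩
  · rcases hcu : c u with a | a <;> rcases hcv : c v with b | b <;> simp_all
    subst hu hv
    rw [hc.2 u v a b hcu hcv]
    have : a ≠ b → u ≠ v := by rintro hab rfl; simp_all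
    tauto
  · rcases hcu : c u with a | a <;> rcases hcv : c v with b | b <;> simp_all
    subst hu hv
    rw [hc.1 u v a b hcu hcv]
    simp

theorem isPolar_compl_iff {s t : ℕ} {G : SimpleGraph V} : IsPolar s t Gᶜ ↔ IsPolar t s G :=
  ⟨fun h => compl_compl G ▸ h.compl, .compl⟩

theorem IsPolarColoring.sum {α β γ : Type*} {G : SimpleGraph V} {H : SimpleGraph W}
    {c : V → α ⊕ β} {d : W → α ⊕ γ} (hc : IsPolarColoring G c) (hd : IsPolarColoring H d)
    (h : ∀ u w i j, c u = .inl i → d w = .inl j → i = j) :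
    IsPolarColoring (G ⊕g H)
      (Sum.elim (Sum.map id Sum.inl ∘ c) (Sum.map id Sum.inr ∘ d) : V ⊕ W → α ⊕ (β ⊕ γ)) := by
  have hc' := hc.map (.refl α) (.inl : β ↪ β ⊕ γ)
  have hd' := hd.map (.refl α) (.inr : γ ↪ β ⊕ γ)
  refine ⟨fun u v i j hu hv => ?_, fun u v i j hu hv => ?_⟩
  · rcases u with u | u <;> rcases v with v | v
    · simpa using hc'.1 u v i j hu hv
    · have := h u v i j
      rcases hcu : c u with a | a <;> rcases hcv : d v with b | b <;> simp_all
    · have := h v u j i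
      rcases hcu : d u with a | a <;> rcases hcv : c v with b | b <;> simp_all
    · simpa using hd'.1 u v i j hu hv
  · rcases u with u | u <;> rcases v with v | v
    · simpa using hc'.2 u v i j hu hv
    · rcases hcu : c u with a | a <;> rcases hcv : d v with b | b <;> simp_all
      rw [← hu, ← hv]; simp
    · rcases hcu : d u with a | a <;> rcases hcv : c v with b | b <;> simp_all
      rw [← hu, ← hv]; simp
    · simpa using hd'.2 u v i j hu hv

/-- Only the colours actually used count. This lets the clique colours of a disjoint union be shared
out between its two sides. -/
theorem IsPolarColoring.isPolar_of_subset {s t : ℕ} {α β : Type*} {G : SimpleGraph V}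
    {c : V → α ⊕ β} (h : IsPolarColoring G c) (P : Set α) (Q : Set β) [Fintype P] [Fintype Q]
    (hP : ∀ u i, c u = .inl i → i ∈ P) (hQ : ∀ u i, c u = .inr i → i ∈ Q)
    (hs : Fintype.card P ≤ s) (ht : Fintype.card Q ≤ t) : IsPolar s t G := by
  have (u : V) : ∃ x : P ⊕ Q, Sum.map Subtype.val Subtype.val x = c u := by
    rcases hu : c u with i | i
    · exact ⟨.inl ⟨i, hP u i hu⟩, rfl⟩
    · exact ⟨.inr ⟨i, hQ u i hu⟩, rfl⟩
  choose d hd using this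
  refine IsPolarColoring.isPolar (c := d)
    ⟨fun u v i j hu hv => ?_, fun u v i j hu hv => ?_⟩ hs ht
  · simpa [Subtype.ext_iff] using h.1 u v i j (by simp [← hd, hu]) (by simp [← hd, hv])
  · simpa [Subtype.ext_iff] using h.2 u v i j (by simp [← hd, hu]) (by simp [← hd, hv])

/-! ### Polarity of disjoint unions and complete graphs -/

theorem isPolar_sum_iff {s t : ℕ} {G : SimpleGraph V} {H : SimpleGraph W} :
    IsPolar s t (G ⊕g H) ↔ ∃ t₁ t₂, t₁ + t₂ = t ∧
      (IsPolar s t₁ G ∧ IsPolar 0 t₂ H ∨ IsPolar 0 t₁ G ∧ IsPolar s t₂ H ∨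
        1 ≤ s ∧ IsPolar 1 t₁ G ∧ IsPolar 1 t₂ H) := by
  classical
  constructor
  · intro h
    obtain ⟨c, hc⟩ := isPolar_iff.1 h
    -- The clique colours used on G. No clique crosses between the sides, so H uses only colours
    -- outside T, and t splits as |T| + |Tᶜ|.
    let T : Set (Fin t) := {i | ∃ u, c (.inl u) = .inr i}
    have hT : Fintype.card T + Fintype.card (Tᶜ : Set (Fin t)) = t := by
      rw [Fintype.card_compl_set, Fintype.card_fin]
      have : Fintype.card T ≤ Fintype.card (Fin t) := set_fintype_card_le_univ T
      simp only [Fintype.card_fin] at this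
      omega
    refine ⟨_, _, hT, ?_⟩
    have hG := hc.comp (SimpleGraph.Embedding.sumInl : G ↪g G ⊕g H)
    have hH := hc.comp (SimpleGraph.Embedding.sumInr : H ↪g G ⊕g H)
    have hcross (u w i) (hu : c (.inl u) = .inr i) : c (.inr w) ≠ .inr i := by
      intro hw
      simpa using hc.2 _ _ _ _ hu hw
    have hcross' (u w i j) (hu : c (.inl u) = .inl i) (hw : c (.inr w) = .inl j) : i = j := by
      simpa using hc.1 _ _ _ _ hu hw
    have hQG (u i) (hu : (c ∘ Sum.inl) u = .inr i) : i ∈ T := ⟨u, hu⟩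
    have hQH (w i) (hw : (c ∘ Sum.inr) w = .inr i) : i ∈ Tᶜ := fun ⟨u, hu⟩ => hcross u w i hu hw
    -- If part colours occur on both sides, `hcross'` makes them all equal: this is the single
    -- independent part.
    by_cases hl : ∃ u i, c (.inl u) = .inl i
    · by_cases hr : ∃ w i, c (.inr w) = .inl i
      · obtain ⟨u, i, hu⟩ := hl
        obtain ⟨w, j, hw⟩ := hr
        obtain rfl := hcross' u w i j hu hw
        exact .inr <| .inr ⟨i.pos,
          hG.isPolar_of_subset {i} T (fun u' i' h' => hcross' u' w i' i h' hw) hQG (by simp) le_rfl,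
          hH.isPolar_of_subset {i} Tᶜ (fun w' i' h' => (hcross' u w' i i' hu h').symm) hQH
            (by simp) le_rfl⟩
      · exact .inl
          ⟨hG.isPolar_of_subset Set.univ T (fun _ _ _ => trivial) hQG (by simp) le_rfl,
          hH.isPolar_of_subset ∅ Tᶜ (fun w i h' => hr ⟨w, i, h'⟩) hQH (by simp) le_rfl⟩
    · exact .inr <| .inl
        ⟨hG.isPolar_of_subset ∅ T (fun w i h' => hl ⟨w, i, h'⟩) hQG (by simp) le_rfl,
        hH.isPolar_of_subset Set.univ Tᶜ (fun _ _ _ => trivial) hQH (by simp) le_rfl⟩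
  · rintro ⟨t₁, t₂, rfl, h | h | h⟩
    · obtain ⟨c, hc⟩ := isPolar_iff.1 h.1
      obtain ⟨d, hd⟩ := isPolar_iff.1 h.2
      refine (hc.sum (hd.map (Fin.castLEEmb (Nat.zero_le s)) (.refl _)) ?_).isPolar
        (by simp) (by simp)
      intro u w i j _ hw
      rcases hdw : d w with b | b
      · exact b.elim0
      · simp [hdw] at hw
    · obtain ⟨c, hc⟩ := isPolar_iff.1 h.1
      obtain ⟨d, hd⟩ := isPolar_iff.1 h.2
      refine ((hc.map (Fin.castLEEmb (Nat.zero_le s)) (.refl _)).sum hd ?_).isPolar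
        (by simp) (by simp)
      intro u w i j hu _
      rcases hdw : c u with b | b
      · exact b.elim0
      · simp [hdw] at hu
    · obtain ⟨c, hc⟩ := isPolar_iff.1 h.2.1
      obtain ⟨d, hd⟩ := isPolar_iff.1 h.2.2
      exact (hc.sum hd fun _ _ _ _ _ _ => Subsingleton.elim _ _).isPolar
        (by simpa using h.1) (by simp)

theorem isPolar_top_iff {s t : ℕ} [Fintype V] :
    IsPolar s t (⊤ : SimpleGraph V) ↔ 1 ≤ t ∨ Fintype.card V ≤ s := by
  refine ⟨fun h => ?_, ?_⟩
  · obtain ⟨c, hc⟩ := isPolar_iff.1 h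
    by_contra! hst
    obtain rfl : t = 0 := by omega
    -- With no clique colour available, adjacent vertices need distinct part colours, so the whole
    -- clique is coloured injectively.
    have : Function.Injective c := by
      intro u v huv
      rcases hv : c v with i | i
      · simpa using hc.1 u v i i (huv.trans hv) hv
      · exact i.elim0
    have := Fintype.card_le_of_injective c this
    simp at this
    omega
  · rintro (h | h)
    · refine IsPolarColoring.isPolar (α := Empty) (β := Unit) (c := fun _ => .inr ())
        ⟨by simp, by simp⟩ (by simp) (by simpa)
    · exact IsPolarColoring.isPolar (α := V) (β := Empty) (c := fun u => .inl u)
        ⟨by simp, by simp⟩ h (by simp)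

/-! ### The calculus of corners -/

/-- `L` lists pairs `(a, b)` generating the set of all `(s, t)` such that `G` is
`(s, t)`-polar. -/
def IsCorners (G : SimpleGraph V) (L : List (ℕ × ℕ)) : Prop :=
  ∀ s t, IsPolar s t G ↔ ∃ p ∈ L, p.1 ≤ s ∧ p.2 ≤ t

theorem IsCorners.congr {G : SimpleGraph V} {H : SimpleGraph W} {L : List (ℕ × ℕ)}
    (h : IsCorners H L) (e : G ≃g H) : IsCorners G L := fun s t => (isPolar_congr e).trans (h s t)

theorem IsCorners.compl {G : SimpleGraph V} {L : List (ℕ × ℕ)} (h : IsCorners G L) :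
    IsCorners Gᶜ (L.map Prod.swap) := by
  intro s t
  rw [isPolar_compl_iff, h]
  constructor
  · rintro ⟨p, hp, h⟩
    exact ⟨p.swap, List.mem_map_of_mem hp, h.2, h.1⟩
  · rintro ⟨_, hr, h⟩
    obtain ⟨p, hp, rfl⟩ := List.mem_map.1 hr
    exact ⟨p, hp, h.2, h.1⟩

/-- The corners of a disjoint union in terms of the corners of the summands. -/
def sumCorners (L M : List (ℕ × ℕ)) : List (ℕ × ℕ) :=
  L.flatMap fun p => M.flatMap fun q =>
    if p.1 = 0 ∨ q.1 = 0 ∨ p.1 ≤ 1 ∧ q.1 ≤ 1 then [(max p.1 q.1, p.2 + q.2)] else []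

theorem mem_sumCorners {L M : List (ℕ × ℕ)} {r : ℕ × ℕ} :
    r ∈ sumCorners L M ↔ ∃ p ∈ L, ∃ q ∈ M, (p.1 = 0 ∨ q.1 = 0 ∨ p.1 ≤ 1 ∧ q.1 ≤ 1) ∧
      r = (max p.1 q.1, p.2 + q.2) := by
  simp only [sumCorners, List.mem_flatMap, List.mem_ite_nil_right, List.mem_singleton]

theorem IsCorners.sum {G : SimpleGraph V} {H : SimpleGraph W} {L M : List (ℕ × ℕ)}
    (hG : IsCorners G L) (hH : IsCorners H M) : IsCorners (G ⊕g H) (sumCorners L M) := by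
  intro s t
  rw [isPolar_sum_iff]
  constructor
  · rintro ⟨t₁, t₂, rfl, h⟩
    simp only [hG _ _, hH _ _] at h
    rcases h with ⟨⟨p, hp, h⟩, q, hq, h'⟩ | ⟨⟨p, hp, h⟩, q, hq, h'⟩ | ⟨h₁, ⟨p, hp, h⟩, q, hq, h'⟩ <;>
      exact ⟨_, mem_sumCorners.2 ⟨p, hp, q, hq, by omega, rfl⟩, by simp; omega, by simp; omega⟩
  · rintro ⟨_, hr, h⟩
    obtain ⟨p, hp, q, hq, hpq, rfl⟩ := mem_sumCorners.1 hr
    simp only [sup_le_iff] at h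
    -- G gets exactly the clique colours its generator needs; all the slack goes to H.
    refine ⟨p.2, t - p.2, by omega, ?_⟩
    simp only [hG _ _, hH _ _]
    have h₁ : q.1 = 0 ∨ p.1 = 0 ∨ 1 ≤ s ∧ p.1 ≤ 1 ∧ q.1 ≤ 1 := by omega
    rcases h₁ with h₁ | h₁ | h₁
    · exact .inl ⟨⟨p, hp, h.1.1, le_rfl⟩, q, hq, h₁.le, by omega⟩
    · exact .inr <| .inl ⟨⟨p, hp, h₁.le, le_rfl⟩, q, hq, h.1.2, by omega⟩
    · exact .inr <| .inr ⟨h₁.1, ⟨p, hp, h₁.2.1, le_rfl⟩, q, hq, h₁.2.2, by omega⟩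

theorem isCorners_top [Fintype V] :
    IsCorners (⊤ : SimpleGraph V) [(0, 1), (Fintype.card V, 0)] := by
  intro s t
  simp [isPolar_top_iff]

theorem isCorners_of_isEmpty [IsEmpty V] (G : SimpleGraph V) : IsCorners G [(0, 0)] := by
  intro s t
  simpa using isPolar_iff.2 ⟨isEmptyElim, by simp [IsPolarColoring]⟩

/-! ### Disjoint copies of a clique -/

/-- A bijection that preserves and reflects adjacency is an isomorphism. -/
noncomputable def isoOfBijective {G : SimpleGraph V} {H : SimpleGraph W} (f : V → W)
    (hf : f.Bijective) (h : ∀ u v, H.Adj (f u) (f v) ↔ G.Adj u v) : G ≃g H :=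
  ⟨Equiv.ofBijective f hf, h _ _⟩

/-- The copies of `G` indexed by a successor split into one copy and all other copies. -/
noncomputable def copiesSuccIso (n : ℕ) (i : Fin (n + 1)) (G : SimpleGraph V) :
    copies (n + 1) G ≃g G ⊕g copies n G := by
  refine (isoOfBijective
    (Sum.elim (fun x => (i, x)) fun p => (i.succAbove p.1, p.2)) ⟨?_, ?_⟩ ?_).symm
  · rintro (x | ⟨a, x⟩) (y | ⟨b, y⟩) <;> simp [Fin.succAbove_ne, (Fin.succAbove_ne _ _).symm]
  · rintro ⟨j, x⟩
    rcases Fin.eq_self_or_eq_succAbove i j with rfl | ⟨j, rfl⟩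
    · exact ⟨.inl x, rfl⟩
    · exact ⟨.inr (j, x), rfl⟩
  · rintro (x | ⟨a, x⟩) (y | ⟨b, y⟩) <;>
      simp [copies, Fin.succAbove_ne, (Fin.succAbove_ne _ _).symm]

/-- Corners of `n K_m`. -/
def cliquesCorners (n : ℕ) : ℕ → List (ℕ × ℕ)
  | 0 => [(0, 0)]
  | 1 => [(0, n), (1, 0)]
  | m + 2 => [(0, n), (m + 2, n - 1)]

/-- Corners of the vertex-deleted subgraphs of `n K_m`. -/
def cliquesDel (m : ℕ) : ℕ → List (List (ℕ × ℕ))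
  | 0 => []
  | n + 1 => [sumCorners [(0, 1), (m - 1, 0)] (cliquesCorners n m)]

/-- For m ≥ 2, a multipartite part with an edge lies inside one clique, and an independent one
leaves a vertex of every clique uncovered. So the only gain comes from absorbing a whole clique, at
the cost of m parts. For m = 1 a single part absorbs everything. At n = 0 the truncated `n - 1` is
harmless, since (0, 0) is already a generator. -/
theorem isCorners_copies_top (n m : ℕ) : IsCorners (copies n (K m)) (cliquesCorners n m) := by
  induction n with
  | zero =>
    intro s t
    rw [isCorners_of_isEmpty]
    rcases m with _ | _ | m <;> simp [cliquesCorners]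
  | succ n ih =>
    intro s t
    rw [(isCorners_top.sum ih).congr (copiesSuccIso n 0 (K m)) s t]
    rcases m with _ | _ | m <;> simp [cliquesCorners, sumCorners]
    · omega
    · omega

/-! ### Cographs -/

theorem isCograph_iff {G : SimpleGraph V} : IsCograph G ↔ ∀ a b c d, G.Adj a b → G.Adj b c →
    G.Adj c d → ¬ G.Adj a c → ¬ G.Adj b d → ¬ G.Adj a d → False := by
  constructor
  · intro h a b c d hab hbc hcd hac hbd had
    refine h ⟨⟨⟨![a, b, c, d], ?_⟩, ?_⟩⟩
    · have h₁ : a ≠ c := by rintro rfl; exact had hcd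
      have h₂ : a ≠ d := by rintro rfl; exact hac hcd.symm
      have h₃ : b ≠ d := by rintro rfl; exact had hab
      intro i j
      fin_cases i <;> fin_cases j <;>
        simp [hab.ne, hbc.ne, hcd.ne, hab.ne', hbc.ne', hcd.ne', h₁, h₂, h₃, h₁.symm, h₂.symm,
          h₃.symm]
    · intro i j
      change G.Adj (![a, b, c, d] i) (![a, b, c, d] j) ↔ _
      fin_cases i <;> fin_cases j <;>
        simp [SimpleGraph.pathGraph_adj, hab, hbc, hcd, hac, hbd, had, G.adj_comm b a,
          G.adj_comm c a, G.adj_comm d a, G.adj_comm c b, G.adj_comm d b, G.adj_comm d c]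
  · rintro h ⟨f⟩
    have hf (i j : Fin 4) : G.Adj (f i) (f j) ↔ i.val + 1 = j.val ∨ j.val + 1 = i.val := by
      rw [f.map_adj_iff, SimpleGraph.pathGraph_adj]
    exact h (f 0) (f 1) (f 2) (f 3) (by simp [hf]) (by simp [hf]) (by simp [hf]) (by simp [hf])
      (by simp [hf]) (by simp [hf])

theorem IsCograph.of_embedding {G : SimpleGraph V} {H : SimpleGraph W} (h : IsCograph H)
    (f : G ↪g H) : IsCograph G := fun ⟨g⟩ => h ⟨f.comp g⟩

theorem IsCograph.compl {G : SimpleGraph V} (h : IsCograph G) : IsCograph Gᶜ := by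
  rw [isCograph_iff] at h ⊢
  intro a b c d hab hbc hcd hac hbd had
  have h₁ : a ≠ c := by rintro rfl; exact had hcd
  have h₂ : a ≠ d := by rintro rfl; exact hac hcd.symm
  have h₃ : b ≠ d := by rintro rfl; exact had hab
  simp only [SimpleGraph.compl_adj, not_and, not_not] at *
  -- P_4 is self-complementary: the path a, b, c, d in the complement is the path c, a, d, b in G.
  exact h c a d b (hac h₁).symm (had h₂) (hbd h₃).symm hcd.2 hab.2 fun h => hbc.2 h.symm

/-- P_4 is connected, so an induced copy lies in one summand. -/
theorem IsCograph.sum {G : SimpleGraph V} {H : SimpleGraph W} (hG : IsCograph G)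
    (hH : IsCograph H) : IsCograph (G ⊕g H) := by
  rw [isCograph_iff] at *
  rintro (a | a) (b | b) (c | c) (d | d) <;> simp [-imp_false]
  · simpa using hG a b c d
  · simpa using hH a b c d

theorem isCograph_copies_top (n m : ℕ) : IsCograph (copies n (K m)) := by
  rw [isCograph_iff]
  rintro ⟨i, a⟩ ⟨j, b⟩ ⟨k, c⟩ ⟨l, d⟩
  simp only [copies, SimpleGraph.top_adj]
  rintro ⟨rfl, hab⟩ ⟨rfl, hbc⟩ ⟨rfl, hcd⟩ hac hbd had
  simp_all

theorem isCograph_top : IsCograph (⊤ : SimpleGraph V) := by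
  rw [isCograph_iff]
  intro a b c d hab hbc hcd hac hbd had
  simp_all

/-! ### Complements, joins and vertex deletion -/

theorem induce_compl_eq (G : SimpleGraph V) (S : Set V) : Gᶜ.induce S = (G.induce S)ᶜ := by
  ext u v
  simp [Subtype.ext_iff]

theorem join_eq_compl (G : SimpleGraph V) (H : SimpleGraph W) : G ⊕j H = (Gᶜ ⊕g Hᶜ)ᶜ := by
  ext (u | u) (v | v) <;> simp [join]
  · exact ⟨fun h => ⟨h.ne, fun _ => h⟩, fun h => h.2 h.1⟩
  · exact ⟨fun h => ⟨h.ne, fun _ => h⟩, fun h => h.2 h.1⟩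

/-- Deleting a vertex of the left summand of a disjoint union. -/
noncomputable def sumDeleteInlIso (G : SimpleGraph V) (H : SimpleGraph W) (v : V) :
    (G ⊕g H).induce {.inl v}ᶜ ≃g G.induce {v}ᶜ ⊕g H := by
  refine (isoOfBijective (Sum.elim (fun x => ⟨.inl x.1, fun h => x.2 (Sum.inl_injective h)⟩)
    fun y => ⟨.inr y, by simp⟩) ⟨?_, ?_⟩ ?_).symm
  · rintro (x | x) (y | y) <;> simp [Subtype.ext_iff]
  · rintro ⟨x | x, hx⟩
    · exact ⟨.inl ⟨x, by simpa using hx⟩, rfl⟩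
    · exact ⟨.inr x, rfl⟩
  · rintro (x | x) (y | y) <;> simp

/-- Deleting a vertex of the right summand of a disjoint union. -/
noncomputable def sumDeleteInrIso (G : SimpleGraph V) (H : SimpleGraph W) (w : W) :
    (G ⊕g H).induce {.inr w}ᶜ ≃g G ⊕g H.induce {w}ᶜ := by
  refine (isoOfBijective (Sum.elim (fun x => ⟨.inl x, by simp⟩)
    fun y => ⟨.inr y.1, fun h => y.2 (Sum.inr_injective h)⟩) ⟨?_, ?_⟩ ?_).symm
  · rintro (x | x) (y | y) <;> simp [Subtype.ext_iff]
  · rintro ⟨x | x, hx⟩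
    · exact ⟨.inl x, rfl⟩
    · exact ⟨.inr ⟨x, by simpa using hx⟩, rfl⟩
  · rintro (x | x) (y | y) <;> simp

/-- An isomorphism restricts to the vertex-deleted subgraphs. -/
noncomputable def deleteIso {G : SimpleGraph V} {H : SimpleGraph W} (e : G ≃g H) (v : V) :
    G.induce {v}ᶜ ≃g H.induce {e v}ᶜ := by
  refine ⟨Equiv.subtypeEquiv e.toEquiv fun u => ?_, ?_⟩
  · simp
  · rintro ⟨x, hx⟩ ⟨y, hy⟩
    simp [e.map_adj_iff]

/-! ### Profiles and their instances -/

/-- The data of `G` that decide whether it is a cograph minimal polar obstruction: generators of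
its polarity pairs, and generators of the polarity pairs of all its vertex-deleted subgraphs. -/
class Profile (G : SimpleGraph V) where
  /-- Generators of the pairs `(s, t)` such that `G` is `(s, t)`-polar. -/
  corners : List (ℕ × ℕ)
  /-- The corners of the vertex-deleted subgraphs. -/
  del : List (List (ℕ × ℕ))
  isCorners : IsCorners G corners
  isCorners_del : ∀ v, ∃ L ∈ del, IsCorners (G.induce {v}ᶜ) L
  isCograph : IsCograph G

open Profile

/-- Profiles are transported along isomorphisms. -/
abbrev Profile.ofIso {G : SimpleGraph V} (H : SimpleGraph W) [Profile H] (e : G ≃g H) :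
    Profile G where
  corners := corners H
  del := del H
  isCorners := (isCorners (G := H)).congr e
  isCorners_del v :=
    let ⟨L, hL, h⟩ := isCorners_del (G := H) (e v)
    ⟨L, hL, h.congr (deleteIso e v)⟩
  isCograph := (isCograph (G := H)).of_embedding e.toEmbedding

instance (n : ℕ) : Profile (K n) where
  corners := [(0, 1), (n, 0)]
  del := [[(0, 1), (n - 1, 0)]]
  isCorners := by simpa using isCorners_top (V := Fin n)
  isCorners_del v := by
    refine ⟨_, List.mem_singleton_self _, ?_⟩
    have h : (K n).induce {v}ᶜ = ⊤ := SimpleGraph.induce_top _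
    have := isCorners_top (V := ({v}ᶜ : Set (Fin n)))
    rw [Fintype.card_compl_set] at this
    simpa [h] using this
  isCograph := isCograph_top

instance (G : SimpleGraph V) (H : SimpleGraph W) [Profile G] [Profile H] : Profile (G ⊕g H) where
  corners := sumCorners (corners G) (corners H)
  del := (del G).map (sumCorners · (corners H)) ++ (del H).map (sumCorners (corners G) ·)
  isCorners := isCorners.sum isCorners
  isCorners_del := by
    rintro (v | v)
    · obtain ⟨L, hL, h⟩ := isCorners_del (G := G) v
      exact ⟨_, List.mem_append_left _ (List.mem_map_of_mem hL),
        (h.sum isCorners).congr (sumDeleteInlIso G H v)⟩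
    · obtain ⟨L, hL, h⟩ := isCorners_del (G := H) v
      exact ⟨_, List.mem_append_right _ (List.mem_map_of_mem hL),
        (isCorners.sum h).congr (sumDeleteInrIso G H v)⟩
  isCograph := isCograph.sum isCograph

instance (G : SimpleGraph V) [Profile G] : Profile Gᶜ where
  corners := (corners G).map Prod.swap
  del := (del G).map (List.map Prod.swap)
  isCorners := isCorners.compl
  isCorners_del v := by
    obtain ⟨L, hL, h⟩ := isCorners_del (G := G) v
    exact ⟨_, List.mem_map_of_mem hL, induce_compl_eq G _ ▸ h.compl⟩
  isCograph := isCograph.compl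

instance (G : SimpleGraph V) (H : SimpleGraph W) [Profile G] [Profile H] : Profile (G ⊕j H) :=
  .ofIso (Gᶜ ⊕g Hᶜ)ᶜ (join_eq_compl G H ▸ .refl)

instance (n m : ℕ) : Profile (copies n (K m)) where
  corners := cliquesCorners n m
  del := cliquesDel m n
  isCorners := isCorners_copies_top n m
  isCorners_del := by
    rcases n with _ | n
    · exact fun v => v.1.elim0
    · intro v
      refine ⟨_, List.mem_singleton_self _, ?_⟩
      obtain ⟨L, hL, h⟩ := isCorners_del (G := K m) v.2
      obtain rfl := List.mem_singleton.1 hL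
      -- Splitting off the copy that contains v puts the deleted vertex in the left summand, leaving
      -- K_m minus a vertex plus the remaining copies. By symmetry one list serves every v.
      have e := (deleteIso (copiesSuccIso n v.1 (K m)) v)
      have hv : copiesSuccIso n v.1 (K m) v = .inl v.2 :=
        (copiesSuccIso n v.1 (K m)).symm.injective (by simp; rfl)
      rw [hv] at e
      exact (h.sum (isCorners_copies_top n m)).congr (e.trans (sumDeleteInlIso _ _ _))
  isCograph := isCograph_copies_top n m

/-- The middle vertex of the path is the isolated vertex of the complement. -/
instance : Profile (P 3) :=
  .ofIso (K 1 ⊕g K 2)ᶜ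
    ⟨⟨![.inr 0, .inl 0, .inr 1], Sum.elim ![1] ![0, 2], by decide, by decide⟩, by
      intro u v
      fin_cases u <;> fin_cases v <;> simp [SimpleGraph.pathGraph_adj]⟩

/-- The two non-adjacent pairs of opposite vertices are the two edges of the complement. -/
instance : Profile (C 4) :=
  .ofIso (K 2 ⊕g K 2)ᶜ
    ⟨⟨![.inl 0, .inr 0, .inl 1, .inr 1], Sum.elim ![0, 2] ![1, 3], by decide, by decide⟩, by
      intro u v
      fin_cases u <;> fin_cases v <;> simp [SimpleGraph.cycleGraph_adj] <;> decide⟩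

theorem completeBipartiteGraph_eq_compl :
    completeBipartiteGraph V W = ((⊤ : SimpleGraph V) ⊕g (⊤ : SimpleGraph W))ᶜ := by
  ext (u | u) (v | v) <;> simp

instance (m n : ℕ) : Profile (KB m n) :=
  .ofIso (K m ⊕g K n)ᶜ (completeBipartiteGraph_eq_compl ▸ .refl)

/-- Two copies of `G` form a disjoint union. -/
noncomputable def copiesTwoIso (G : SimpleGraph V) : copies 2 G ≃g G ⊕g G := by
  refine (isoOfBijective (Sum.elim (fun x => (0, x)) fun x => (1, x)) ⟨?_, ?_⟩ ?_).symm
  · rintro (x | x) (y | y) <;> simp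
  · rintro ⟨i, x⟩
    fin_cases i
    · exact ⟨.inl x, rfl⟩
    · exact ⟨.inr x, rfl⟩
  · rintro (x | x) (y | y) <;> simp [copies]

noncomputable instance : Profile (copies 2 (P 3)) := .ofIso (P 3 ⊕g P 3) (copiesTwoIso _)

/-- A proper induced subgraph misses some vertex v, hence embeds in the deletion of v and inherits
its polarity. Both hypotheses are finite checks on lists. -/
theorem isCographMinimalKPolarObstruction_of_profile {k : ℕ} (G : SimpleGraph V) [Profile G]
    (h : ¬ (corners G).any fun p => p.1 ≤ k ∧ p.2 ≤ k)
    (hdel : (del G).all fun L => L.any fun p => p.1 ≤ k ∧ p.2 ≤ k) :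
    IsCographMinimalKPolarObstruction k G := by
  refine ⟨isCograph, fun h' => ?_, fun S hS => ?_⟩
  · obtain ⟨p, hp, h'⟩ := (isCorners k k).1 h'
    exact h (List.any_eq_true.2 ⟨p, hp, decide_eq_true h'⟩)
  · obtain ⟨v, hv⟩ := (Set.ne_univ_iff_exists_notMem S).1 hS
    obtain ⟨L, hL, h'⟩ := isCorners_del (G := G) v
    obtain ⟨p, hp, hpk⟩ := List.any_eq_true.1 (List.all_eq_true.1 hdel L hL)
    exact ((h' k k).2 ⟨p, hp, of_decide_eq_true hpk⟩).of_embedding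
      (SimpleGraph.induceHomOfLE G (Set.subset_compl_singleton_iff.2 hv))

end PolarObstruction

/-! ### The 24 families -/

set_option maxHeartbeats 4000000 in
theorem mainTheorem5 (k : ℕ) (hk : 2 ≤ k) :
    -- family 1
    IsCographMinimalKPolarObstruction k (K 1 ⊕g copies (k + 1) (K 2)) ∧
    -- family 2
    IsCographMinimalKPolarObstruction k (C 4 ⊕g P 3 ⊕g copies (k - 2) (K 2)) ∧
    -- family 3
    IsCographMinimalKPolarObstruction k
      (((K 1 ⊕g copies 2 (K 2)) ⊕j K 1) ⊕g K 1 ⊕g copies (k - 2) (K 2)) ∧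
    -- family 4
    IsCographMinimalKPolarObstruction k
      ((copies 2 (K 2) ⊕g copies (k - 1) (K 1))ᶜ ⊕g copies k (K 1)) ∧
    -- family 5
    IsCographMinimalKPolarObstruction k
      ((copies (k + 1) (K 2))ᶜ ⊕g copies (k - 1) (K 1)) ∧
    -- family 6
    IsCographMinimalKPolarObstruction k (copies 2 (P 3) ⊕g copies (k - 1) (K 2)) ∧
    -- family 7
    IsCographMinimalKPolarObstruction k
      ((P 3 ⊕g K 2)ᶜ ⊕g copies (k - 1) (K 2) ⊕g K 1) ∧
    -- family 8
    IsCographMinimalKPolarObstruction k ((copies 2 (P 3))ᶜ ⊕g copies k (K 1)) ∧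
    -- family 9
    IsCographMinimalKPolarObstruction k (((P 3 ⊕g K 2) ⊕j K 1) ⊕g copies k (K 1)) ∧
    -- family 10
    IsCographMinimalKPolarObstruction k
      ((((K 2 ⊕g copies (k - 1) (K 1))ᶜ ⊕g K 2) ⊕j (K 2)ᶜ) ⊕g copies (k - 1) (K 1)) ∧
    -- family 11
    IsCographMinimalKPolarObstruction k ((copies 2 (P 3) ⊕j K 1) ⊕g copies (k - 1) (K 1)) ∧
    -- family 12
    IsCographMinimalKPolarObstruction k
      ((K 1 ⊕j (K 1 ⊕g (copies 2 (K 1) ⊕j (K 2 ⊕g K 1)))) ⊕g copies (k - 1) (K 1)) ∧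
    -- family 13
    IsCographMinimalKPolarObstruction k
      (C 4 ⊕g copies (k - 1) (K 2) ⊕g copies 2 (K 1)) ∧
    -- family 14
    IsCographMinimalKPolarObstruction k ((K 2 ⊕g copies k (K 1))ᶜ ⊕g copies k (K 2)) ∧
    -- family 15
    IsCographMinimalKPolarObstruction k
      ((copies 2 (K k) ⊕j (K 2)ᶜ) ⊕g copies (k - 1) (K 2)) ∧
    -- family 16
    IsCographMinimalKPolarObstruction k
      ((copies 2 (K 2) ⊕j K 1) ⊕g P 3 ⊕g copies (k - 2) (K 2)) ∧
    -- family 17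
    IsCographMinimalKPolarObstruction k ((copies 2 (K 2) ⊕j K 2) ⊕g copies k (K 1)) ∧
    -- family 18
    IsCographMinimalKPolarObstruction k
      ((copies 2 (K k) ⊕j P 3) ⊕g copies (k - 1) (K 1)) ∧
    -- family 19
    IsCographMinimalKPolarObstruction k
      (((K 2 ⊕g (K 2)ᶜ) ⊕j (K 2)ᶜ) ⊕g (K 2)ᶜ ⊕g copies (k - 2) (K 2)) ∧
    -- family 20
    IsCographMinimalKPolarObstruction k
      (((C 4 ⊕g copies 2 (K 1)) ⊕j K 1) ⊕g K 1 ⊕g copies (k - 2) (K 1)) ∧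
    -- family 21
    IsCographMinimalKPolarObstruction k
      (KB (k + 1) (k + 1) ⊕g copies (k + 1) (K 1)) ∧
    -- family 22
    IsCographMinimalKPolarObstruction k (copies (k + 1) (K (k + 1))) ∧
    -- family 23
    IsCographMinimalKPolarObstruction k
      ((copies 2 (K (k + 1)) ⊕j K 1) ⊕g copies (k - 1) (K 2)) ∧
    -- family 24
    IsCographMinimalKPolarObstruction k
      ((copies 2 (K (k + 1)) ⊕j K 2) ⊕g copies (k - 1) (K 1)) := by
  -- For k = j + 4 even k - 2 is at least 2, so comparisons of such entries with 0 and 1 in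
  -- `sumCorners`, and the case splits on sizes, no longer depend on k. The values 2 and 3 are
  -- separate.
  have hcases : k = 2 ∨ k = 3 ∨ ∃ j, k = j + 4 := by
    rcases k with _ | _ | _ | _ | j <;> simp_all
  refine ⟨?_, ?_, ?_, ?_, ?_, ?_, ?_, ?_, ?_, ?_, ?_, ?_, ?_, ?_, ?_, ?_, ?_, ?_, ?_, ?_, ?_, ?_,
    ?_, ?_⟩ <;> apply isCographMinimalKPolarObstruction_of_profile <;>
    obtain rfl | rfl | ⟨j, rfl⟩ := hcases
  -- Concrete k is settled by evaluating the lists; for symbolic j they are unfolded and any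
  -- leftover linear inequalities go to `omega`.
  all_goals first
    | decide +kernel
    | (simp [Profile.del, Profile.corners, sumCorners, cliquesCorners, cliquesDel] <;> omega)
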